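/- **Setting.** Let $A,E,\beta,\gamma>0$, $N=\lceil\log_2(\gamma(A+2\beta))\rceil$, $Q(x)=\frac1{\sqrt{2\pi}}\int_x^\infty e^{-u^2/2}\,du$, and $\bar\epsilon=2Q(\beta)$. Let the noise bits $(Z_0^b,\dots,Z_{N-1}^b)$ be the $N$-bit representation (two's complement for negative integers) of a random integer $K\in\{-\lceil\gamma A\rceil,\dots,\lceil\gamma(A+2\beta)\rceil-1\}$ with $\mathcal P\{K=k\}$ proportional to $Q\big(\frac{k-\gamma\beta}{\gamma}\big)-Q\big(\frac{k+1-\gamma\beta}{\gamma}\big)$; that is, $K=\lfloor\gamma(Z+\beta)\rfloor$ for a standard Gaussian $Z$ restricted to this range. The vector binary channel with erasures maps input bits $(X_0^b,\dots,X_{N-1}^b)$ to $Y_i^b=(X_i^b+Z_i^b+W_i^b)\bmod 2$, $i=0,\dots,N-1$, with carry-over bits $W_0^b=0$, $W_{i+1}^b=(X_i^bZ_i^b+X_i^bW_i^b+Z_i^bW_i^b)\bmod 2$; independently of everything else the whole output is replaced by an erasure $\xi$ with a probability $\epsilon\le\bar\epsilon$ (in particular $\epsilon=\bar\epsilon$).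 The noise is independent of the input, and the channel is memoryless over time. A transmitted bit vector represents the intensity $X=\gamma^{-1}\sum_iX_i^b2^i$, which must satisfy $X\le A$ and have average at most $E$. Let $q\in\{1,\dots,N-1\}$, and for each $i$ let $\mathcal A_i\subseteq\{i-N+1,\dots,i-1\}$ have $q$ elements. The state of bit-pipe $i$ is $\boldsymbol S_i^b=(Z_j^b)_{j\in\mathcal A_i}$, where $Z_j^b=0$ for $j<0$. In the SD-BSC$_q$ scheme the messages $m_0,\dots,m_{N-1}$ are encoded independently, $m_i$ by a binary code for bit-pipe $i$ with symbols distributed as $\mathrm{Bern}(p_i)$ (all-zero if $p_i=0$), and are decoded successively, $i=0,1,\dots,N-1$. For bit-pipe $i$ the receiver computes $W_i^b$ and $\boldsymbol S_i^b$ from the unerased outputs and the already decoded messages, forms $\overline Y_i=(Y_i^b+W_i^b)\bmod2$, flips this bit if $\mathcal P\{Z_i^b=1\mid\boldsymbol S_i^b\}>\frac12$, discards the state, and decodes $m_i$ from the resulting sequence $\breve Y_i^c$ over $\{0,1,\xi\}$ alone. **Theorem (Rate of SD-BSC$_q$).** Put $\breve\alpha_i=\mathbb E_{\boldsymbol S_i^b}\big[\min\{\mathcal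 P\{Z_i^b=1\mid\boldsymbol S_i^b\},\,1-\mathcal P\{Z_i^b=1\mid\boldsymbol S_i^b\}\}\big]$. (1) If the lower bit-pipes are decoded correctly, then the channel from $X_i^b$ to $\breve Y_i^c$ is, whatever is sent on the other bit-pipes, a memoryless binary symmetric channel with crossover probability $\breve\alpha_i$ concatenated with an erasure channel with erasure probability $\epsilon$. (2) Let $\mathsf h$ be the binary entropy function in bits, and $p\circledast a=p(1-a)+(1-p)a$. The scheme achieves the rate $$R_{\text{SD-BSC}_q}=(1-\bar\epsilon)\max_{p}\sum_{i=0}^{N-1}\big[\mathsf h(p_i\circledast\breve\alpha_i)-\mathsf h(\breve\alpha_i)\big],$$ where the maximum, which is attained, is over all $p\in[0,1]^N$ with $\sum_{i:\,p_i>0}2^i\le\gamma A$ and $\sum_{i:\,p_i>0}p_i2^i\le\gamma E$; and for every such $p$ it achieves $(1-\bar\epsilon)\sum_i[\mathsf h(p_i\circledast\breve\alpha_i)-\mathsf h(\breve\alpha_i)]$ with inputs of composition $p$. Here a rate $R$ is achieved if for every $\delta>0$ and all large block lengths there are codes of this form that satisfy both intensity constraints for every tuple of messages, in which the fraction of ones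 in every codeword of bit-pipe $i$ is within $\delta$ of $p_i$, with total rate at least $R-\delta$ and maximal probability that some message is decoded wrongly at most $\delta$. -/

import Mathlib

namespace IMDD

noncomputable section

/-- The Gaussian tail function `Q(x) = (2π)^(-1/2) ∫_x^∞ exp(-u²/2) du`. -/
def gaussianQ (x : ℝ) : ℝ :=
  1 / Real.sqrt (2 * Real.pi) * ∫ u in Set.Ioi x, Real.exp (-u ^ 2 / 2)

/-- Binary entropy function, in bits. -/
def h2 (x : ℝ) : ℝ := Real.binEntropy x / Real.log 2

/-- Binary convolution `p ⊛ a = p (1 - a) + (1 - p) a`. -/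
def bconv (p a : ℝ) : ℝ := p * (1 - a) + (1 - p) * a

/-- Vectors of `N` bits; entry `i` is the bit of weight `2 ^ i`. -/
abbrev Bits (N : ℕ) := Fin N → ZMod 2

/-- The value at position `j` of a bit vector, `0` at positions outside `0, …, N - 1`. -/
def bitAt {N : ℕ} (x : Bits N) (j : ℤ) : ZMod 2 :=
  if hj : 0 ≤ j ∧ j < N then x ⟨j.toNat, by omega⟩ else 0

/-- The integer `∑ x_i 2^i` (as a real number). -/
def decimal {N : ℕ} (x : Bits N) : ℝ := ∑ i, ((x i).val : ℝ) * 2 ^ (i : ℕ)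

/-! ### Binary noise -/

/-- Bit `i` of the `N`-bit representation of the integer `k`, in two's complement if `k < 0`:
`⌊(2^N 1_{k<0} + k) / 2^i⌋ mod 2`. -/
def noiseBit (N : ℕ) (k : ℤ) (i : ℕ) : ZMod 2 :=
  ((((if k < 0 then (2 : ℤ) ^ N else 0) + k) / 2 ^ i : ℤ) : ZMod 2)

/-- The joint law of the noise bits `(Z_0, …, Z_{N-1})`: the `N`-bit representation of
`⌊γ (Z + β)⌋`, where `Z` is standard Gaussian and `γ (Z + β)` is restricted
to `[-⌈γ A⌉, ⌈γ (A + 2 β)⌉)`. -/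
def noiseLaw (A β γ : ℝ) (N : ℕ) (z : Bits N) : ℝ :=
  (∑ k ∈ (Finset.Ico (-⌈γ * A⌉) ⌈γ * (A + 2 * β)⌉).filter
      (fun k => ∀ i : Fin N, noiseBit N k i = z i),
    (gaussianQ (((k : ℝ) - γ * β) / γ) - gaussianQ (((k : ℝ) + 1 - γ * β) / γ))) /
  (gaussianQ ((-(⌈γ * A⌉ : ℝ) - γ * β) / γ) -
    gaussianQ (((⌈γ * (A + 2 * β)⌉ : ℝ) - γ * β) / γ))

/-! ### The vector binary channel -/

/-- The carry-over bits `W_0 = 0`, `W_{i+1} = X_i Z_i + X_i W_i + Z_i W_i`. -/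
def carry {N : ℕ} (x z : Bits N) : ℕ → ZMod 2
  | 0 => 0
  | i + 1 => bitAt x i * bitAt z i + bitAt x i * carry x z i + bitAt z i * carry x z i

/-- The unerased output `Y_i = X_i + Z_i + W_i` (mod 2). -/
def vbcOutput {N : ℕ} (x z : Bits N) : Bits N := fun i => x i + z i + carry x z i

/-- Transition probabilities of the vector binary channel with noise law `pZ` and erasure
probability `e`. An erasure (`none`) hits all bit-pipes of a channel use together, and
is independent of the input and of the noise. -/
def vbc {N : ℕ} (pZ : Bits N → ℝ) (e : ℝ) (x : Bits N) : Option (Bits N) → ℝ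
  | none => e
  | some y => (1 - e) * ∑ z : Bits N, if vbcOutput x z = y then pZ z else 0

open Classical in
/-- Probability that the output block of `n` independent uses of the channel with input
block `x` has the property `P`. -/
def blockProb {N n : ℕ} (pZ : Bits N → ℝ) (e : ℝ) (x : Fin n → Bits N)
    (P : (Fin n → Option (Bits N)) → Prop) : ℝ :=
  ∑ y : Fin n → Option (Bits N), if P y then ∏ t, vbc pZ e (x t) (y t) else 0

/-- Transition probabilities of a binary symmetric channel with crossover probability `a`
followed by an erasure channel with erasure probability `e`. -/
def bscErasure (a e : ℝ) (x : ZMod 2) : Option (ZMod 2) → ℝ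
  | none => e
  | some y => (1 - e) * if y = x then 1 - a else a

/-! ### State bits -/

/-- The state `(Z_j)_{j ∈ S}`, with `Z_j = 0` for negative `j`. -/
def stateOf {N : ℕ} (S : Finset ℤ) (z : Bits N) : S → ZMod 2 := fun j => bitAt z j

/-- `P{S = s}`. -/
def stateProb {N : ℕ} (pZ : Bits N → ℝ) (S : Finset ℤ) (s : S → ZMod 2) : ℝ :=
  ∑ z : Bits N, if stateOf S z = s then pZ z else 0

/-- `P{Z_i = 1 | S = s}` (with value `0` if `P{S = s} = 0`). -/
def condProb {N : ℕ} (pZ : Bits N → ℝ) (S : Finset ℤ) (i : Fin N) (s : S → ZMod 2) : ℝ :=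
  (∑ z : Bits N, if z i = 1 ∧ stateOf S z = s then pZ z else 0) / stateProb pZ S s

/-- `E_S[min {P{Z_i = 1 | S}, 1 - P{Z_i = 1 | S}}]`. -/
def crossover {N : ℕ} (pZ : Bits N → ℝ) (S : Finset ℤ) (i : Fin N) : ℝ :=
  ∑ s : S → ZMod 2, stateProb pZ S s * min (condProb pZ S i s) (1 - condProb pZ S i s)

/-! ### Receiver processing -/

/-- Carry-over bits as the receiver computes them from an unerased output `y` and
the (decoded) input bits `x`; entry `i` uses only the bits of `x` below position `i`. -/
def recCarry {N : ℕ} (x y : Bits N) : ℕ → ZMod 2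
  | 0 => 0
  | i + 1 =>
      let z := bitAt y i + bitAt x i + recCarry x y i
      bitAt x i * z + bitAt x i * recCarry x y i + z * recCarry x y i

/-- Noise bits as the receiver computes them: `Z_i = Y_i + X_i + W_i`. -/
def recNoise {N : ℕ} (x y : Bits N) : Bits N := fun i => y i + x i + recCarry x y i

/-- The processed output of bit-pipe `i`: subtract the carry-over, and flip the result
if `P{Z_i = 1 | state} > 1/2`. With `S` a set of positions below `i`, only the bits of
`x` below position `i` are used. -/
def flipOutput {N : ℕ} (pZ : Bits N → ℝ) (S : Finset ℤ) (i : Fin N) (x : Bits N) :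
    Option (Bits N) → Option (ZMod 2)
  | none => none
  | some y =>
      if condProb pZ S i (stateOf S (recNoise x y)) ≤ 1 / 2 then
        some (y i + recCarry x y i)
      else
        some (1 + (y i + recCarry x y i))

/-! ### Codes -/

/-- A code of block length `n` for independent encoding over `N` bit-pipes: for each
bit-pipe a message set of size `M i`, a binary encoder, and a decoder whose only input is
a block over `{0, 1, erasure}`. -/
structure PipeCode (N n : ℕ) where
  M : Fin N → ℕ
  enc : (i : Fin N) → Fin (M i) → Fin n → ZMod 2
  dec : (i : Fin N) → (Fin n → Option (ZMod 2)) → Fin (M i)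

namespace PipeCode

variable {N n : ℕ}

/-- The channel input block of a tuple of messages. -/
def input (C : PipeCode N n) (m : (i : Fin N) → Fin (C.M i)) : Fin n → Bits N :=
  fun t i => C.enc i (m i) t

/-- The receiver's reconstruction of the input bits of the bit-pipes below `k` (with `0`
on the others) after successive decoding of bit-pipes `0, …, k - 1`. Bit-pipe `k` is decoded
from its processed output, the carry-over and the state being computed from
the decoded messages of the lower bit-pipes. -/
def estInput (C : PipeCode N n) (pZ : Bits N → ℝ) (S : Fin N → Finset ℤ)
    (y : Fin n → Option (Bits N)) : ℕ → Fin n → Bits N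
  | 0 => fun _ _ => 0
  | k + 1 =>
      if hk : k < N then fun t =>
        Function.update (estInput C pZ S y k t) ⟨k, hk⟩
          (C.enc ⟨k, hk⟩
            (C.dec ⟨k, hk⟩ fun t' =>
              flipOutput pZ (S ⟨k, hk⟩) ⟨k, hk⟩ (estInput C pZ S y k t') (y t')) t)
      else estInput C pZ S y k

/-- The message of bit-pipe `i` as decoded by the successive receiver. -/
def decoded (C : PipeCode N n) (pZ : Bits N → ℝ) (S : Fin N → Finset ℤ)
    (y : Fin n → Option (Bits N)) (i : Fin N) : Fin (C.M i) :=
  C.dec i fun t => flipOutput pZ (S i) i (C.estInput pZ S y i t) (y t)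

/-- Probability that some message is decoded wrongly when `m` is sent. -/
def errorProb (C : PipeCode N n) (pZ : Bits N → ℝ) (e : ℝ) (S : Fin N → Finset ℤ)
    (m : (i : Fin N) → Fin (C.M i)) : ℝ :=
  blockProb pZ e (C.input m) fun y => ∃ i, C.decoded pZ S y i ≠ m i

/-- Total rate, in bits per channel use. -/
def rate (C : PipeCode N n) : ℝ := (∑ i, Real.logb 2 (C.M i)) / n

/-- The fraction of ones in a codeword. -/
def onesFraction (C : PipeCode N n) (i : Fin N) (m : Fin (C.M i)) : ℝ :=
  (∑ t, ((C.enc i m t).val : ℝ)) / n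

/-- Peak constraint: every transmitted symbol `X = γ⁻¹ ∑ X_i 2^i` is at most `A`. -/
def PeakConstraint (C : PipeCode N n) (γ A : ℝ) : Prop :=
  ∀ m t, decimal (C.input m t) / γ ≤ A

/-- Average constraint: the time average of every transmitted block is at most `E`. -/
def AverageConstraint (C : PipeCode N n) (γ E : ℝ) : Prop :=
  ∀ m, (∑ t, decimal (C.input m t) / γ) / n ≤ E

end PipeCode

/-- Admissible `(p_i)`: probabilities with `∑_{p_i > 0} 2^i ≤ γ A` and
`∑_{p_i > 0} p_i 2^i ≤ γ E`. -/
def admissible (A E γ : ℝ) (N : ℕ) : Set (Fin N → ℝ) :=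
  {p | (∀ i, 0 ≤ p i ∧ p i ≤ 1) ∧
    ∑ i with 0 < p i, (2 : ℝ) ^ (i : ℕ) ≤ γ * A ∧
    ∑ i with 0 < p i, p i * (2 : ℝ) ^ (i : ℕ) ≤ γ * E}

/-- The total rate `R` is achieved by successive decoding with flipped outputs and
`Bern(p i)` inputs: for each `δ > 0` and all large `n` there are codes, unused (all-zero) on
the bit-pipes with `p i = 0`, with codewords whose fraction of ones is within `δ` of `p i`,
obeying the peak and average constraints, of rate at least `R - δ` and maximal
error probability at most `δ`. -/
def Achieves {N : ℕ} (A E γ : ℝ) (pZ : Bits N → ℝ) (e : ℝ) (S : Fin N → Finset ℤ)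
    (p : Fin N → ℝ) (R : ℝ) : Prop :=
  ∀ δ > 0, ∃ n₀ : ℕ, ∀ n ≥ n₀, ∃ C : PipeCode N n,
    (∀ i, p i = 0 → ∀ m t, C.enc i m t = 0) ∧
    (∀ i m, |C.onesFraction i m - p i| ≤ δ) ∧
    C.PeakConstraint γ A ∧ C.AverageConstraint γ E ∧
    R - δ ≤ C.rate ∧ ∀ m, C.errorProb pZ e S m ≤ δ

/-- `∑_i h(p_i ⊛ a_i) - h(a_i)`. -/
def sumRate {N : ℕ} (a p : Fin N → ℝ) : ℝ := ∑ i, (h2 (bconv (p i) (a i)) - h2 (a i))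

end

end IMDD

namespace IMDD

/-!
The carry bits and the state of bit-pipe `i` are functions of the output and of the inputs below
position `i`, so with correctly decoded lower bit-pipes the processed output is the input plus a
residual noise bit. This bit is `1` with conditional probability `P{Z_i = 1 | S}` or its complement,
whichever is at most `1/2`, whatever the inputs are, and averaging over the state gives a binary
symmetric channel with the average of these probabilities as crossover probability.

Good codes for each bit-pipe come from Feinstein's maximal code construction: the typical input
blocks for `Bern(p_i - η)` are codewords with at most `p_i n` ones, whose number is governed by the
mutual information of the single bit-pipe through the weak law of large numbers. Successive
decoding fails only if some decoder fails on the output processed with the true inputs, so the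
error probabilities add up. The maximum is attained because the cost of the support of `p` is
lower semicontinuous, which makes the set of admissible `p` compact.
-/

open Filter Topology Finset

section ProductLaw

variable {ι α β : Type*} [Fintype ι] [DecidableEq ι] [Fintype α]

lemma sum_filter_forall_prod [DecidableEq β] (μ : ι → α → ℝ) (f : ι → α → β) (v : ι → β) :
    ∑ ω : ι → α with ∀ t, f t (ω t) = v t, ∏ t, μ t (ω t) = ∏ t, ∑ a with f t a = v t, μ t a := by
  rw [Finset.prod_univ_sum]
  congr 1
  ext ω
  simp

lemma sum_filter_comp_prod [Fintype β] [DecidableEq β] (μ : ι → α → ℝ) (f : ι → α → β)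
    (G : (ι → β) → Prop) [DecidablePred G] :
    ∑ ω : ι → α with G fun t => f t (ω t), ∏ t, μ t (ω t) =
      ∑ v with G v, ∏ t, ∑ a with f t a = v t, μ t a := by
  rw [← Finset.sum_fiberwise_of_maps_to (g := fun (ω : ι → α) t => f t (ω t))
    (t := Finset.univ.filter G) fun ω hω => by simpa using hω]
  refine Finset.sum_congr rfl fun v hv => ?_
  rw [← sum_filter_forall_prod, Finset.filter_filter]
  refine Finset.sum_congr (Finset.filter_congr fun ω _ => ?_) fun _ _ => rfl
  rw [← funext_iff]
  exact and_iff_right_of_imp fun h => h ▸ (Finset.mem_filter.1 hv).2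

lemma prod_mem_stdSimplex {μ : ι → α → ℝ} (hμ : ∀ t, μ t ∈ stdSimplex ℝ α) :
    (fun ω : ι → α => ∏ t, μ t (ω t)) ∈ stdSimplex ℝ (ι → α) := by
  refine ⟨fun ω => Finset.prod_nonneg fun t _ => (hμ t).1 _, ?_⟩
  rw [← Fintype.piFinset_univ, ← Finset.prod_univ_sum]
  exact Finset.prod_eq_one fun t _ => (hμ t).2

end ProductLaw

section WeakLaw

open MeasureTheory ProbabilityTheory

variable {α : Type*} [Fintype α]

lemma exists_probabilityMeasure_of_mem_stdSimplex [MeasurableSpace α] [MeasurableSingletonClass α]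
    {μ : α → ℝ} (hμ : μ ∈ stdSimplex ℝ α) :
    ∃ ν : Measure α, IsProbabilityMeasure ν ∧ ∀ a, ν.real {a} = μ a := by
  have hsum : ∑ a, ENNReal.ofReal (μ a) = 1 := by
    rw [← ENNReal.ofReal_sum_of_nonneg fun a _ => hμ.1 a, hμ.2, ENNReal.ofReal_one]
  refine ⟨(PMF.ofFintype _ hsum).toMeasure, inferInstance, fun a => ?_⟩
  rw [measureReal_def, PMF.toMeasure_apply_singleton _ _ (measurableSet_singleton a)]
  exact ENNReal.toReal_ofReal (hμ.1 a)

theorem tendsto_sum_deviation {μ : α → ℝ} (hμ : μ ∈ stdSimplex ℝ α) (f : α → ℝ) {η : ℝ}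
    (hη : 0 < η) :
    Tendsto (fun n : ℕ => ∑ ω : Fin n → α with n * η < |∑ t, f (ω t) - n * ∑ a, μ a * f a|,
      ∏ t, μ (ω t)) atTop (𝓝 0) := by
  let _ : MeasurableSpace α := ⊤
  obtain ⟨ν, _, hν⟩ := exists_probabilityMeasure_of_mem_stdSimplex hμ
  have hmean : ∫ a, f a ∂ν = ∑ a, μ a * f a := by
    simp [integral_fintype, hν]
  refine squeeze_zero (g := fun n : ℕ => Var[f; ν] / η ^ 2 / n)
    (fun n => Finset.sum_nonneg fun ω _ => Finset.prod_nonneg fun t _ => hμ.1 _) (fun n => ?_)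
    (tendsto_const_div_atTop_nhds_zero_nat _)
  rcases n.eq_zero_or_pos with rfl | hn
  · simp
  set νn : Measure (Fin n → α) := Measure.pi fun _ => ν
  have hνn (ω : Fin n → α) : νn.real {ω} = ∏ t, μ (ω t) := by
    simp only [νn, measureReal_def, Measure.pi_singleton, ENNReal.toReal_prod, ← hν]
  set X : (Fin n → α) → ℝ := ∑ t, fun ω => f (ω t) with hX
  have hXmean : ∫ ω, X ω ∂νn = n * ∑ a, μ a * f a := by
    have hcoord (t : Fin n) : ∫ ω, f (ω t) ∂νn = ∑ a, μ a * f a :=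
      (integral_comp_eval (μ := fun _ => ν) (Measurable.of_discrete (f := f)).aestronglyMeasurable)
        |>.trans hmean
    simp only [hX, Finset.sum_apply]
    rw [integral_finsetSum _ fun _ _ => .of_finite]
    simp [hcoord]
  have hXvar : Var[X; νn] = n * Var[f; ν] := by
    rw [hX, variance_sum_pi fun _ => .of_discrete]
    simp
  calc ∑ ω : Fin n → α with n * η < |∑ t, f (ω t) - n * ∑ a, μ a * f a|, ∏ t, μ (ω t)
    _ ≤ νn.real {ω | n * η ≤ |X ω - ∫ ω, X ω ∂νn|} := by
        simp only [← hνn]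
        rw [sum_measureReal_singleton, hXmean]
        refine measureReal_mono fun ω hω => ?_
        simpa [hX] using (Finset.mem_filter.1 hω).2.le
    _ ≤ Var[X; νn] / (n * η) ^ 2 :=
        ENNReal.toReal_le_of_le_ofReal (div_nonneg (variance_nonneg _ _) (sq_nonneg _))
          (meas_ge_le_variance_div_sq .of_discrete (by positivity))
    _ = Var[f; ν] / η ^ 2 / n := by
        rw [hXvar]
        field_simp

end WeakLaw

section Feinstein

variable {𝒳 𝒴 : Type*}

/-- The law of the output of the channel `W` whose input has law `P`. -/
noncomputable def outputLaw [Fintype 𝒳] (P : 𝒳 → ℝ) (W : 𝒳 → 𝒴 → ℝ) (y : 𝒴) : ℝ :=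
  ∑ x, P x * W x y

/-- The joint law of the input and the output of the channel `W` whose input has law `P`. -/
def jointLaw (P : 𝒳 → ℝ) (W : 𝒳 → 𝒴 → ℝ) (a : 𝒳 × 𝒴) : ℝ := P a.1 * W a.1 a.2

variable [Fintype 𝒳] [Fintype 𝒴] {P : 𝒳 → ℝ} {W : 𝒳 → 𝒴 → ℝ}

lemma jointLaw_mem_stdSimplex (hP : P ∈ stdSimplex ℝ 𝒳) (hW : ∀ x, W x ∈ stdSimplex ℝ 𝒴) :
    jointLaw P W ∈ stdSimplex ℝ (𝒳 × 𝒴) := by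
  refine ⟨fun a => mul_nonneg (hP.1 _) ((hW _).1 _), ?_⟩
  simp only [jointLaw, Fintype.sum_prod_type, ← mul_sum, (hW _).2, mul_one, hP.2]

lemma one_le_sum_add_sum_add_sum_compl [DecidableEq 𝒴] {w : 𝒴 → ℝ} (hw : w ∈ stdSimplex ℝ 𝒴)
    (U : Finset 𝒴) (p : 𝒴 → Prop) [DecidablePred p] :
    1 ≤ ∑ y with ¬ p y, w y + ∑ y ∈ U, w y + ∑ y ∈ Uᶜ with p y, w y := by
  rw [← hw.2, ← sum_add_sum_compl U, ← sum_filter_add_sum_filter_not Uᶜ p]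
  have hsub : ∑ y ∈ Uᶜ with ¬ p y, w y ≤ ∑ y with ¬ p y, w y :=
    sum_le_sum_of_subset_of_nonneg (filter_subset_filter _ (subset_univ _)) fun y _ _ => hw.1 y
  linarith

variable (F : 𝒳 → Prop) [DecidablePred F] {ε θ : ℝ}

/- The forbidden inputs, the unlikely pairs and the outputs in `U` have total mass less than `ε`, so
some allowed input makes an unlikely output or one in `U` appear with probability less than `ε`. -/
lemma exists_codeword [DecidableEq 𝒴] (hP : P ∈ stdSimplex ℝ 𝒳)
    (hW : ∀ x, W x ∈ stdSimplex ℝ 𝒴) (hε : ε ≤ 1) (U : Finset 𝒴)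
    (h : ∑ x with ¬ F x, P x +
      ∑ a with W a.1 a.2 < θ * outputLaw P W a.2, jointLaw P W a +
      ∑ y ∈ U, outputLaw P W y < ε) :
    ∃ x, F x ∧ 1 - ε ≤ ∑ y ∈ Uᶜ with θ * outputLaw P W y ≤ W x y, W x y := by
  by_contra! hcon
  have hinput (x : 𝒳) : P x * ε ≤ (if ¬ F x then P x else 0) +
      ∑ y with W x y < θ * outputLaw P W y, P x * W x y + ∑ y ∈ U, P x * W x y := by
    simp only [← mul_sum]
    by_cases hF : F x
    · have hcover := one_le_sum_add_sum_add_sum_compl (hW x) U fun y => θ * outputLaw P W y ≤ W x y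
      simp only [not_le] at hcover
      rw [if_neg (not_not.2 hF), zero_add, ← mul_add]
      exact mul_le_mul_of_nonneg_left (by linarith [hcon x hF]) (hP.1 x)
    · rw [if_pos hF, add_assoc, ← mul_add]
      have hsum_nonneg (s : Finset 𝒴) : 0 ≤ ∑ y ∈ s, W x y := sum_nonneg fun y _ => (hW x).1 y
      nlinarith [hP.1 x, mul_nonneg (hP.1 x) (add_nonneg
        (hsum_nonneg {y | W x y < θ * outputLaw P W y}) (hsum_nonneg U))]
  refine h.not_ge ?_
  calc ε = ∑ x, P x * ε := by rw [← sum_mul, hP.2, one_mul]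
    _ ≤ _ := sum_le_sum fun x _ => hinput x
    _ = _ := by
      rw [sum_add_distrib, sum_add_distrib, ← sum_filter, sum_comm (s := univ) (t := U)]
      simp only [sum_filter, Fintype.sum_prod_type]
      rfl

lemma exists_codewords_disjoint (hP : P ∈ stdSimplex ℝ 𝒳) (hW : ∀ x, W x ∈ stdSimplex ℝ 𝒴)
    (hε : ε ≤ 1) (hθ : 0 < θ) (M : ℕ)
    (h : ∑ x with ¬ F x, P x +
      ∑ a with W a.1 a.2 < θ * outputLaw P W a.2, jointLaw P W a + (M - 1) / θ < ε) :
    ∃ (c : Fin M → 𝒳) (D : Fin M → Finset 𝒴), (∀ j, F (c j)) ∧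
      (∀ j, 1 - ε ≤ ∑ y ∈ D j, W (c j) y) ∧ (∀ j, ∀ y ∈ D j, θ * outputLaw P W y ≤ W (c j) y) ∧
      Pairwise fun j k => Disjoint (D j) (D k) := by
  classical
  induction M with
  | zero => exact ⟨Fin.elim0, Fin.elim0, nofun, nofun, nofun, nofun⟩
  | succ M ih =>
    push_cast at h
    obtain ⟨c, D, hF, hsucc, hlik, hdisj⟩ := ih <| h.trans_le' <| by gcongr; simp
    have hU : ∑ y ∈ univ.biUnion D, outputLaw P W y ≤ M / θ := by
      rw [sum_biUnion fun j _ k _ hjk => hdisj hjk]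
      refine (sum_le_card_nsmul _ _ (1 / θ) fun j _ => ?_).trans_eq (by simp [div_eq_mul_inv])
      rw [le_div_iff₀' hθ, mul_sum, ← (hW (c j)).2]
      exact (sum_le_sum fun y hy => hlik j y hy).trans
        (sum_le_univ_sum_of_nonneg (hW (c j)).1)
    obtain ⟨x, hFx, hx⟩ := exists_codeword F hP hW hε (univ.biUnion D) (θ := θ) <| by
      rw [add_sub_cancel_right] at h
      linarith
    set D₀ : Finset 𝒴 := {y ∈ (univ.biUnion D)ᶜ | θ * outputLaw P W y ≤ W x y}
    have hD₀ (j : Fin M) : Disjoint D₀ (D j) :=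
      disjoint_left.2 fun y hy hyj =>
        mem_compl.1 (mem_filter.1 hy).1 (mem_biUnion.2 ⟨j, mem_univ j, hyj⟩)
    refine ⟨Fin.cons x c, Fin.cons D₀ D, ?_, ?_, ?_, ?_⟩
    · exact Fin.forall_fin_succ.2 ⟨hFx, hF⟩
    · exact Fin.forall_fin_succ.2 ⟨hx, hsucc⟩
    · exact Fin.forall_fin_succ.2 ⟨fun y hy => (mem_filter.1 hy).2, hlik⟩
    · simpa [Pairwise, Fin.forall_fin_succ, hD₀, fun j => (hD₀ j).symm] using @hdisj

theorem feinstein (hP : P ∈ stdSimplex ℝ 𝒳) (hW : ∀ x, W x ∈ stdSimplex ℝ 𝒴)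
    (hε : ε ≤ 1) (hθ : 0 < θ) (m : ℕ)
    (h : ∑ x with ¬ F x, P x +
      ∑ a with W a.1 a.2 < θ * outputLaw P W a.2, jointLaw P W a + m / θ < ε) :
    ∃ (enc : Fin (m + 1) → 𝒳) (dec : 𝒴 → Fin (m + 1)), (∀ j, F (enc j)) ∧
      ∀ j, ∑ y with dec y ≠ j, W (enc j) y ≤ ε := by
  classical
  obtain ⟨c, D, hF, hsucc, -, hdisj⟩ :=
    exists_codewords_disjoint F hP hW hε hθ (m + 1) (by simpa using h)
  let dec (y : 𝒴) : Fin (m + 1) := if hy : ∃ j, y ∈ D j then hy.choose else 0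
  have hdec {j : Fin (m + 1)} {y : 𝒴} (hy : y ∈ D j) : dec y = j := by
    have hex : ∃ j, y ∈ D j := ⟨j, hy⟩
    simp only [dec, dif_pos hex]
    by_contra hne
    exact disjoint_left.1 (hdisj hne) hex.choose_spec hy
  refine ⟨c, dec, hF, fun j => ?_⟩
  calc ∑ y with dec y ≠ j, W (c j) y ≤ ∑ y ∈ (D j)ᶜ, W (c j) y :=
        sum_le_sum_of_subset_of_nonneg
          (fun y hy => mem_compl.2 fun hyD => (mem_filter.1 hy).2 (hdec hyD))
          fun y _ _ => (hW _).1 y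
    _ ≤ ε := by linarith [hsucc j, (hW (c j)).2, sum_add_sum_compl (D j) (W (c j))]

end Feinstein

section ChannelCoding

variable {𝒳 𝒴 : Type*} {n : ℕ}

/-- The law of `n` independent input symbols of law `P`. -/
noncomputable def blockLaw (P : 𝒳 → ℝ) (x : Fin n → 𝒳) : ℝ := ∏ t, P (x t)

/-- The channel given by `n` independent uses of the channel `W`. -/
noncomputable def blockChannel (W : 𝒳 → 𝒴 → ℝ) (x : Fin n → 𝒳) (y : Fin n → 𝒴) : ℝ :=
  ∏ t, W (x t) (y t)

lemma blockChannel_mem_stdSimplex [Fintype 𝒴] {W : 𝒳 → 𝒴 → ℝ}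
    (hW : ∀ x, W x ∈ stdSimplex ℝ 𝒴) (x : Fin n → 𝒳) :
    blockChannel W x ∈ stdSimplex ℝ (Fin n → 𝒴) :=
  prod_mem_stdSimplex fun t => hW (x t)

variable [Fintype 𝒳] {P : 𝒳 → ℝ} {W : 𝒳 → 𝒴 → ℝ}

lemma outputLaw_blockChannel (y : Fin n → 𝒴) :
    outputLaw (blockLaw P) (blockChannel W) y = ∏ t, outputLaw P W (y t) := by
  simp only [outputLaw, blockLaw, blockChannel, ← prod_mul_distrib, prod_univ_sum,
    Fintype.piFinset_univ]

/-- The information density `log (W(y|x) / Q(y))` of an input-output pair, where `Q` is the output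
law; it is only meaningful on the support of the joint law. -/
noncomputable def infoDensity (P : 𝒳 → ℝ) (W : 𝒳 → 𝒴 → ℝ) (a : 𝒳 × 𝒴) : ℝ :=
  Real.log (W a.1 a.2 / outputLaw P W a.2)

variable [Fintype 𝒴]

/-- The mutual information, in nats, between the input, of law `P`, and the output of the
channel `W`. -/
noncomputable def mutualInfo (P : 𝒳 → ℝ) (W : 𝒳 → 𝒴 → ℝ) : ℝ :=
  ∑ a, jointLaw P W a * infoDensity P W a

lemma pos_of_jointLaw_ne_zero (hP : P ∈ stdSimplex ℝ 𝒳) (hW : ∀ x, W x ∈ stdSimplex ℝ 𝒴)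
    {a : 𝒳 × 𝒴} (ha : jointLaw P W a ≠ 0) : 0 < W a.1 a.2 ∧ 0 < outputLaw P W a.2 := by
  have hjoint : 0 < P a.1 * W a.1 a.2 := ((jointLaw_mem_stdSimplex hP hW).1 a).lt_of_ne' ha
  exact ⟨((hW _).1 _).lt_of_ne' (right_ne_zero_of_mul ha), hjoint.trans_le <|
    single_le_sum (f := fun x => P x * W x a.2)
      (fun x _ => mul_nonneg (hP.1 x) ((hW x).1 _)) (mem_univ a.1)⟩

lemma mutualInfo_eq_sum_negMulLog (hP : P ∈ stdSimplex ℝ 𝒳) (hW : ∀ x, W x ∈ stdSimplex ℝ 𝒴) :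
    mutualInfo P W =
      ∑ y, Real.negMulLog (outputLaw P W y) - ∑ x, P x * ∑ y, Real.negMulLog (W x y) := by
  have hlog (a : 𝒳 × 𝒴) : jointLaw P W a * infoDensity P W a =
      P a.1 * W a.1 a.2 * (Real.log (W a.1 a.2) - Real.log (outputLaw P W a.2)) := by
    by_cases ha : jointLaw P W a = 0
    · rw [ha, zero_mul, show P a.1 * W a.1 a.2 = 0 from ha, zero_mul]
    · obtain ⟨hWa, hQa⟩ := pos_of_jointLaw_ne_zero hP hW ha
      rw [infoDensity, Real.log_div hWa.ne' hQa.ne', jointLaw]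
  simp only [mutualInfo, hlog, Fintype.sum_prod_type, mul_sub, sum_sub_distrib]
  rw [sum_comm (f := fun x y => P x * W x y * Real.log (outputLaw P W y))]
  simp only [Real.negMulLog, mul_sum, neg_mul, mul_neg, sum_neg_distrib, neg_sub_neg]
  simp only [← mul_assoc, ← sum_mul, outputLaw]

lemma blockLaw_mem_stdSimplex (hP : P ∈ stdSimplex ℝ 𝒳) :
    blockLaw P ∈ stdSimplex ℝ (Fin n → 𝒳) :=
  prod_mem_stdSimplex fun _ => hP

/- On the support of the joint law, the logarithm of the likelihood ratio of a block is
the sum of the information densities of its symbols. -/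
lemma sum_unlikely_le (hP : P ∈ stdSimplex ℝ 𝒳) (hW : ∀ x, W x ∈ stdSimplex ℝ 𝒴) (η : ℝ) :
    ∑ a : (Fin n → 𝒳) × (Fin n → 𝒴) with blockChannel W a.1 a.2 <
      Real.exp (n * (mutualInfo P W - η)) * outputLaw (blockLaw P) (blockChannel W) a.2,
      jointLaw (blockLaw P) (blockChannel W) a ≤
    ∑ ω : Fin n → 𝒳 × 𝒴 with n * η < |∑ t, infoDensity P W (ω t) - n * mutualInfo P W|,
      ∏ t, jointLaw P W (ω t) := by
  rw [sum_filter, sum_filter,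
    ← (Equiv.arrowProdEquivProdArrow (Fin n) (fun _ => 𝒳) (fun _ => 𝒴)).sum_comp]
  refine sum_le_sum fun ω _ => ?_
  have hjoint : jointLaw (blockLaw P) (blockChannel W)
      (Equiv.arrowProdEquivProdArrow (Fin n) (fun _ => 𝒳) (fun _ => 𝒴) ω) =
      ∏ t, jointLaw P W (ω t) := prod_mul_distrib.symm
  have hnonneg : 0 ≤ ∏ t, jointLaw P W (ω t) :=
    prod_nonneg fun t _ => (jointLaw_mem_stdSimplex hP hW).1 _
  rw [hjoint, outputLaw_blockChannel]
  rcases hnonneg.eq_or_lt' with hzero | hpos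
  · simp [hzero]
  have hω (t : Fin n) : 0 < W (ω t).1 (ω t).2 ∧ 0 < outputLaw P W (ω t).2 :=
    pos_of_jointLaw_ne_zero hP hW fun h0 => hpos.ne' (prod_eq_zero (mem_univ t) h0)
  have hdensity : ∑ t, infoDensity P W (ω t) =
      Real.log ((∏ t, W (ω t).1 (ω t).2) / ∏ t, outputLaw P W (ω t).2) := by
    rw [← prod_div_distrib, Real.log_prod fun t _ => (div_pos (hω t).1 (hω t).2).ne']
    rfl
  have hdev : ∏ t, W (ω t).1 (ω t).2 <
        Real.exp (n * (mutualInfo P W - η)) * ∏ t, outputLaw P W (ω t).2 →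
      n * η < |∑ t, infoDensity P W (ω t) - n * mutualInfo P W| := fun hlt => by
    rw [← div_lt_iff₀ (prod_pos fun t _ => (hω t).2),
      ← Real.log_lt_iff_lt_exp (div_pos (prod_pos fun t _ => (hω t).1)
        (prod_pos fun t _ => (hω t).2)), ← hdensity] at hlt
    exact lt_abs.2 (Or.inr (by linarith))
  split_ifs with hunlikely hdeviates
  · exact le_rfl
  · exact absurd (hdev hunlikely) hdeviates
  · exact hpos.le
  · exact le_rfl

lemma tendsto_sum_unlikely (hP : P ∈ stdSimplex ℝ 𝒳) (hW : ∀ x, W x ∈ stdSimplex ℝ 𝒴) {R : ℝ}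
    (hR : R < mutualInfo P W) :
    Tendsto (fun n : ℕ => ∑ a : (Fin n → 𝒳) × (Fin n → 𝒴) with blockChannel W a.1 a.2 <
      Real.exp (n * R) * outputLaw (blockLaw P) (blockChannel W) a.2,
      jointLaw (blockLaw P) (blockChannel W) a) atTop (𝓝 0) := by
  have hjoint := jointLaw_mem_stdSimplex hP hW
  refine squeeze_zero (fun n => sum_nonneg fun a _ => ?_) (fun n => ?_)
    (tendsto_sum_deviation hjoint (infoDensity P W) (sub_pos.2 hR))
  · exact (jointLaw_mem_stdSimplex (blockLaw_mem_stdSimplex hP)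
      (blockChannel_mem_stdSimplex hW)).1 a
  · have hle := sum_unlikely_le (n := n) hP hW (mutualInfo P W - R)
    rw [sub_sub_cancel] at hle
    exact hle

theorem channel_coding (hP : P ∈ stdSimplex ℝ 𝒳) (hW : ∀ x, W x ∈ stdSimplex ℝ 𝒴) (g : 𝒳 → ℝ)
    {R η ε : ℝ} (hR : R < mutualInfo P W) (hη : 0 < η) (hε : 0 < ε) :
    ∀ᶠ n : ℕ in atTop, ∃ (M : ℕ) (enc : Fin M → Fin n → 𝒳) (dec : (Fin n → 𝒴) → Fin M),
      Real.exp (n * R) ≤ M ∧ (∀ m, |∑ t, g (enc m t) - n * ∑ x, P x * g x| ≤ n * η) ∧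
      ∀ m, ∑ y with dec y ≠ m, blockChannel W (enc m) y ≤ ε := by
  obtain ⟨R', hRR', hR'⟩ := exists_between hR
  have hcount : Tendsto (fun n : ℕ => (⌊Real.exp (n * R)⌋₊ : ℝ) / Real.exp (n * R')) atTop
      (𝓝 0) := by
    refine squeeze_zero (fun n => by positivity) (fun n => ?_) <|
      Real.tendsto_exp_neg_atTop_nhds_zero.comp <|
        tendsto_natCast_atTop_atTop.atTop_mul_const (sub_pos.2 hRR')
    rw [div_le_iff₀ (Real.exp_pos _), Function.comp_apply, ← Real.exp_add]
    exact (Nat.floor_le (Real.exp_pos _).le).trans_eq (by ring_nf)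
  have htotal := ((tendsto_sum_deviation hP g hη).add (tendsto_sum_unlikely hP hW hR')).add hcount
  rw [add_zero, add_zero] at htotal
  filter_upwards [htotal.eventually_lt_const (lt_min hε one_pos)] with n hn
  obtain ⟨enc, dec, htyp, herr⟩ := feinstein
    (fun x : Fin n → 𝒳 => |∑ t, g (x t) - n * ∑ x, P x * g x| ≤ n * η)
    (blockLaw_mem_stdSimplex hP) (blockChannel_mem_stdSimplex hW)
    (min_le_right ε 1) (Real.exp_pos (n * R')) ⌊Real.exp (n * R)⌋₊
    (by simpa only [not_le, blockLaw] using hn)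
  exact ⟨_, enc, dec, by exact_mod_cast (Nat.lt_floor_add_one _).le, htyp,
    fun m => (herr m).trans (min_le_left _ _)⟩

end ChannelCoding

section NoiseLaw

lemma integrable_exp_neg_sq_div_two :
    MeasureTheory.Integrable fun u : ℝ => Real.exp (-u ^ 2 / 2) := by
  convert integrable_exp_neg_mul_sq (b := 1 / 2) (by norm_num) using 3
  ring

lemma gaussianQ_strictAnti : StrictAnti gaussianQ := fun x y hxy => by
  rw [← sub_pos, gaussianQ, gaussianQ, ← mul_sub, intervalIntegral.integral_Ioi_sub_Ioi
    integrable_exp_neg_sq_div_two.integrableOn hxy.le]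
  exact mul_pos (by positivity) (intervalIntegral.intervalIntegral_pos_of_pos_on
    integrable_exp_neg_sq_div_two.intervalIntegrable (fun _ _ => Real.exp_pos _) hxy)

lemma gaussianQ_zero : gaussianQ 0 = 1 / 2 := by
  have hexponent (u : ℝ) : -u ^ 2 / 2 = -(1 / 2) * u ^ 2 := by ring
  simp only [gaussianQ, hexponent, integral_gaussian_Ioi]
  rw [show Real.pi / (1 / 2) = 2 * Real.pi by ring]
  field_simp

lemma gaussianQ_lt_half {x : ℝ} (hx : 0 < x) : gaussianQ x < 1 / 2 :=
  gaussianQ_zero ▸ gaussianQ_strictAnti hx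

lemma sum_Ico_sub_add_one (f : ℤ → ℝ) {a b : ℤ} (h : a ≤ b) :
    ∑ k ∈ Ico a b, (f k - f (k + 1)) = f a - f b := by
  induction b, h using Int.leInduction with
  | base => simp
  | succ b hb ih =>
    rw [← insert_Ico_right_eq_Ico_add_one hb, sum_insert (by simp), ih]
    ring

lemma noiseLaw_mem_stdSimplex {A β γ : ℝ} (hA : 0 < A) (hβ : 0 < β) (hγ : 0 < γ) (N : ℕ) :
    noiseLaw A β γ N ∈ stdSimplex ℝ (Bits N) := by
  set tail : ℤ → ℝ := fun k => gaussianQ ((k - γ * β) / γ) with htail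
  have htail_anti : StrictAnti tail := fun k l hkl =>
    gaussianQ_strictAnti (by gcongr)
  have hrange : -⌈γ * A⌉ < ⌈γ * (A + 2 * β)⌉ :=
    (neg_neg_of_pos (Int.ceil_pos.2 (by positivity))).trans (Int.ceil_pos.2 (by positivity))
  have hnoise (z : Bits N) : noiseLaw A β γ N z =
      (∑ k ∈ Ico (-⌈γ * A⌉) ⌈γ * (A + 2 * β)⌉ with (fun i : Fin N => noiseBit N k i) = z,
        (tail k - tail (k + 1))) / (tail (-⌈γ * A⌉) - tail ⌈γ * (A + 2 * β)⌉) := by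
    simp only [noiseLaw, htail, funext_iff]
    push_cast
    rfl
  have hden : 0 < tail (-⌈γ * A⌉) - tail ⌈γ * (A + 2 * β)⌉ := sub_pos.2 (htail_anti hrange)
  refine ⟨fun z => ?_, ?_⟩
  · rw [hnoise]
    exact div_nonneg (sum_nonneg fun k _ => sub_nonneg.2 (htail_anti (lt_add_one k)).le) hden.le
  · simp only [hnoise, ← sum_div]
    rw [sum_fiberwise, sum_Ico_sub_add_one tail hrange.le, div_self hden.ne']

end NoiseLaw

section Receiver

variable {N : ℕ}

lemma bitAt_natCast (x : Bits N) {i : ℕ} (hi : i < N) : bitAt x i = x ⟨i, hi⟩ := by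
  rw [bitAt, dif_pos (by omega)]
  simp

lemma bitAt_congr {x x' : Bits N} {k : ℤ} (h : ∀ j : Fin N, (j : ℤ) = k → x j = x' j) :
    bitAt x k = bitAt x' k := by
  unfold bitAt
  split_ifs with hk
  · exact h _ (Int.toNat_of_nonneg hk.1)
  · rfl

lemma vbcOutput_add_carry (x z : Bits N) (i : Fin N) :
    vbcOutput x z i + carry x z i = x i + z i := by
  rw [vbcOutput, CharTwo.add_cancel_right]

lemma vbcOutput_add_add_carry (x z : Bits N) (i : Fin N) :
    vbcOutput x z i + x i + carry x z i = z i := by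
  rw [add_right_comm, vbcOutput_add_carry, add_right_comm, CharTwo.add_self_eq_zero, zero_add]

lemma recCarry_vbcOutput (x z : Bits N) {i : ℕ} (hi : i ≤ N) :
    recCarry x (vbcOutput x z) i = carry x z i := by
  induction i with
  | zero => rfl
  | succ i ih =>
    rw [recCarry, carry, ih (by omega), bitAt_natCast z hi, bitAt_natCast x hi,
      bitAt_natCast (vbcOutput x z) hi, vbcOutput_add_add_carry x z ⟨i, hi⟩]

lemma recNoise_vbcOutput (x z : Bits N) : recNoise x (vbcOutput x z) = z := by
  funext i
  rw [recNoise, recCarry_vbcOutput x z i.2.le, vbcOutput_add_add_carry]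

lemma recCarry_congr {x x' y : Bits N} {i : ℕ} (h : ∀ j : Fin N, (j : ℕ) < i → x j = x' j) :
    recCarry x y i = recCarry x' y i := by
  induction i with
  | zero => rfl
  | succ i ih =>
    rw [recCarry, recCarry, ih fun j hj => h j (by omega),
      bitAt_congr fun j hj => h j (by omega)]

lemma flipOutput_congr (pZ : Bits N → ℝ) {S : Finset ℤ} {i : Fin N}
    (hS : ∀ j ∈ S, j < (i : ℤ)) {x x' : Bits N} (h : ∀ j < i, x j = x' j) (y : Option (Bits N)) :
    flipOutput pZ S i x y = flipOutput pZ S i x' y := by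
  cases y with
  | none => rfl
  | some y =>
    have hcarry (k : ℕ) (hk : k ≤ i) : recCarry x y k = recCarry x' y k :=
      recCarry_congr fun j hj => h j (hj.trans_le hk)
    have hstate : stateOf S (recNoise x y) = stateOf S (recNoise x' y) := by
      funext ⟨j, hj⟩
      refine bitAt_congr fun k hk => ?_
      have hki : k < i := Fin.lt_def.2 (Int.ofNat_lt.1 (hk.trans_lt (hS j hj)))
      rw [recNoise, recNoise, h k hki, hcarry k hki.le]
    simp only [flipOutput, hcarry i le_rfl, hstate]

/-- The noise bit `Z_i` after the receiver's flip, that is, the error that remains on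
bit-pipe `i`. -/
noncomputable def residualNoise (pZ : Bits N → ℝ) (S : Finset ℤ) (i : Fin N) (z : Bits N) :
    ZMod 2 :=
  if condProb pZ S i (stateOf S z) ≤ 1 / 2 then z i else 1 + z i

lemma flipOutput_vbcOutput (pZ : Bits N → ℝ) (S : Finset ℤ) (i : Fin N) (x z : Bits N) :
    flipOutput pZ S i x (some (vbcOutput x z)) = some (x i + residualNoise pZ S i z) := by
  simp only [flipOutput, residualNoise, recNoise_vbcOutput, recCarry_vbcOutput x z i.2.le,
    vbcOutput_add_carry]
  split_ifs
  · rfl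
  · rw [add_left_comm]

end Receiver

section Crossover

variable {N : ℕ} {pZ : Bits N → ℝ}

lemma stateProb_mul_condProb (hpZ : ∀ z, 0 ≤ pZ z) (S : Finset ℤ) (i : Fin N) (s : S → ZMod 2) :
    stateProb pZ S s * condProb pZ S i s = ∑ z with z i = 1 ∧ stateOf S z = s, pZ z := by
  have hle : ∑ z with z i = 1 ∧ stateOf S z = s, pZ z ≤ stateProb pZ S s := by
    rw [stateProb, ← sum_filter]
    exact sum_le_sum_of_subset_of_nonneg (monotone_filter_right _ fun z _ hz => hz.2)
      fun z _ _ => hpZ z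
  rw [condProb, ← sum_filter]
  exact mul_div_cancel_of_imp' fun h => le_antisymm (hle.trans_eq h) (sum_nonneg fun z _ => hpZ z)

lemma stateProb_mul_one_sub_condProb (hpZ : ∀ z, 0 ≤ pZ z) (S : Finset ℤ) (i : Fin N)
    (s : S → ZMod 2) :
    stateProb pZ S s * (1 - condProb pZ S i s) = ∑ z with 1 + z i = 1 ∧ stateOf S z = s, pZ z := by
  have hbit (b : ZMod 2) : 1 + b = 1 ↔ b ≠ 1 := by revert b; decide
  rw [mul_one_sub, stateProb_mul_condProb hpZ, stateProb, ← sum_filter, sub_eq_iff_eq_add',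
    ← sum_filter_add_sum_filter_not _ fun z : Bits N => z i = 1]
  simp only [filter_filter, hbit, and_comm]

lemma crossover_eq_sum_filter (hpZ : ∀ z, 0 ≤ pZ z) (S : Finset ℤ) (i : Fin N) :
    crossover pZ S i = ∑ z with residualNoise pZ S i z = 1, pZ z := by
  rw [crossover, ← sum_fiberwise _ (stateOf S)]
  refine sum_congr rfl fun s _ => ?_
  rw [filter_filter]
  rcases le_or_gt (condProb pZ S i s) (1 / 2) with hs | hs
  · rw [min_eq_left (by linarith), stateProb_mul_condProb hpZ]
    refine sum_congr (filter_congr fun z _ => and_congr_left ?_) fun _ _ => rfl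
    rintro rfl
    rw [residualNoise, if_pos hs]
  · rw [min_eq_right (by linarith), stateProb_mul_one_sub_condProb hpZ]
    refine sum_congr (filter_congr fun z _ => and_congr_left ?_) fun _ _ => rfl
    rintro rfl
    rw [residualNoise, if_neg hs.not_ge]

lemma crossover_mem_Icc (hpZ : pZ ∈ stdSimplex ℝ (Bits N)) (S : Finset ℤ) (i : Fin N) :
    crossover pZ S i ∈ Set.Icc 0 1 := by
  rw [crossover_eq_sum_filter hpZ.1]
  exact ⟨sum_nonneg fun z _ => hpZ.1 z, (sum_le_univ_sum_of_nonneg hpZ.1).trans_eq hpZ.2⟩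

/-- The Bernoulli law on `ZMod 2`. -/
def bern (p : ℝ) (x : ZMod 2) : ℝ := if x = 1 then p else 1 - p

lemma sum_filter_residualNoise (hpZ : pZ ∈ stdSimplex ℝ (Bits N)) (S : Finset ℤ) (i : Fin N)
    (b : ZMod 2) : ∑ z with residualNoise pZ S i z = b, pZ z = bern (crossover pZ S i) b := by
  rw [bern, crossover_eq_sum_filter hpZ.1]
  split_ifs with hb
  · rw [hb]
  · have hcompl (c : ZMod 2) : c = b ↔ ¬ c = 1 := by revert b c; decide
    rw [← hpZ.2, ← sum_filter_add_sum_filter_not univ fun z => residualNoise pZ S i z = 1,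
      add_sub_cancel_left]
    simp only [hcompl]

end Crossover

section VectorChannel

variable {N n : ℕ} {pZ : Bits N → ℝ} {e : ℝ}

lemma sum_filter_vbc (pZ : Bits N → ℝ) (e : ℝ) (x : Bits N) (G : Option (Bits N) → Prop)
    [DecidablePred G] :
    ∑ y with G y, vbc pZ e x y =
      (if G none then e else 0) + (1 - e) * ∑ z with G (some (vbcOutput x z)), pZ z := by
  have hvbc (y : Bits N) : (if G (some y) then vbc pZ e x (some y) else 0) =
      (1 - e) * ∑ z, if vbcOutput x z = y then (if G (some y) then pZ z else 0) else 0 := by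
    split_ifs
    · rfl
    · simp
  rw [sum_filter, Fintype.sum_option]
  simp only [hvbc, ← mul_sum]
  rw [sum_comm]
  simp only [sum_ite_eq, mem_univ, if_true, sum_filter]
  rfl

lemma vbc_mem_stdSimplex (hpZ : pZ ∈ stdSimplex ℝ (Bits N)) (he : e ∈ Set.Icc 0 1)
    (x : Bits N) : vbc pZ e x ∈ stdSimplex ℝ (Option (Bits N)) := by
  refine ⟨?_, ?_⟩
  · rintro (_ | y)
    · exact he.1
    · exact mul_nonneg (sub_nonneg.2 he.2) (sum_nonneg fun z _ => ite_nonneg (hpZ.1 z) le_rfl)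
  · simpa [hpZ.2] using sum_filter_vbc pZ e x fun _ => True

lemma bscErasure_some (a e : ℝ) (x y : ZMod 2) :
    bscErasure a e x (some y) = (1 - e) * bern a (x + y) := by
  have hflip : y = x ↔ ¬ x + y = 1 := by revert x y; decide
  simp only [bscErasure, bern, hflip, ite_not]

lemma sum_filter_flipOutput_vbc (hpZ : pZ ∈ stdSimplex ℝ (Bits N)) (e : ℝ) (S : Finset ℤ)
    (i : Fin N) (x : Bits N) (v : Option (ZMod 2)) :
    ∑ y with flipOutput pZ S i x y = v, vbc pZ e x y =
      bscErasure (crossover pZ S i) e (x i) v := by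
  rw [sum_filter_vbc]
  simp only [flipOutput_vbcOutput]
  cases v with
  | none => simp [flipOutput, bscErasure]
  | some w =>
    have hnoise (b : ZMod 2) : x i + b = w ↔ b = x i + w := by
      rw [add_comm, CharTwo.add_eq_iff_eq_add, add_comm w]
    simp only [Option.some_inj, hnoise, sum_filter_residualNoise hpZ, bscErasure_some]
    simp [flipOutput]

open Classical in
lemma blockProb_eq_sum_filter (pZ : Bits N → ℝ) (e : ℝ) (x : Fin n → Bits N)
    (P : (Fin n → Option (Bits N)) → Prop) :
    blockProb pZ e x P = ∑ y with P y, ∏ t, vbc pZ e (x t) (y t) := by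
  rw [blockProb, sum_filter]

lemma blockProb_le_sum {ι : Type*} [Fintype ι] (hpZ : pZ ∈ stdSimplex ℝ (Bits N))
    (he : e ∈ Set.Icc 0 1) (x : Fin n → Bits N) {P : (Fin n → Option (Bits N)) → Prop}
    {Q : ι → (Fin n → Option (Bits N)) → Prop} (h : ∀ y, P y → ∃ i, Q i y) :
    blockProb pZ e x P ≤ ∑ i, blockProb pZ e x (Q i) := by
  classical
  have hprod (y : Fin n → Option (Bits N)) : 0 ≤ ∏ t, vbc pZ e (x t) (y t) :=
    prod_nonneg fun t _ => (vbc_mem_stdSimplex hpZ he (x t)).1 _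
  simp only [blockProb_eq_sum_filter, sum_filter]
  rw [sum_comm]
  refine sum_le_sum fun y _ => ?_
  have hterm (i : ι) : 0 ≤ if Q i y then ∏ t, vbc pZ e (x t) (y t) else 0 :=
    ite_nonneg (hprod y) le_rfl
  split_ifs with hP
  · obtain ⟨i, hi⟩ := h y hP
    simpa [hi] using single_le_sum (fun i _ => hterm i) (mem_univ i)
  · exact sum_nonneg fun i _ => hterm i

lemma blockProb_comp_flipOutput (hpZ : pZ ∈ stdSimplex ℝ (Bits N)) (e : ℝ) (S : Finset ℤ)
    (i : Fin N) (x : Fin n → Bits N) (G : (Fin n → Option (ZMod 2)) → Prop) [DecidablePred G] :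
    blockProb pZ e x (fun y => G fun t => flipOutput pZ S i (x t) (y t)) =
      ∑ v with G v, ∏ t, bscErasure (crossover pZ S i) e (x t i) (v t) := by
  simp only [blockProb_eq_sum_filter, ← sum_filter_flipOutput_vbc hpZ, ← sum_filter_comp_prod]
  congr

lemma blockProb_flipOutput (hpZ : pZ ∈ stdSimplex ℝ (Bits N)) (e : ℝ) (S : Finset ℤ)
    (i : Fin N) (x : Fin n → Bits N) (v : Fin n → Option (ZMod 2)) :
    blockProb pZ e x (fun y => ∀ t, flipOutput pZ S i (x t) (y t) = v t) =
      ∏ t, bscErasure (crossover pZ S i) e (x t i) (v t) := by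
  simp only [← funext_iff]
  exact (blockProb_comp_flipOutput hpZ e S i x (· = v)).trans (by simp [filter_eq'])

end VectorChannel

section BinaryCodes

variable {p a e : ℝ}

lemma sum_zmod_two (f : ZMod 2 → ℝ) : ∑ x, f x = f 0 + f 1 := Fin.sum_univ_two f

lemma sum_bern_mul (p : ℝ) (f : ZMod 2 → ℝ) :
    ∑ x, bern p x * f x = (1 - p) * f 0 + p * f 1 := by
  simp [sum_zmod_two, bern]

lemma bern_mem_stdSimplex (hp : p ∈ Set.Icc 0 1) : bern p ∈ stdSimplex ℝ (ZMod 2) :=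
  ⟨fun _ => ite_nonneg hp.1 (sub_nonneg.2 hp.2), by simpa using sum_bern_mul p 1⟩

lemma sum_comp_bscErasure (a e : ℝ) (x : ZMod 2) (f : ℝ → ℝ) :
    ∑ y, f (bscErasure a e x y) = f e + (f ((1 - e) * (1 - a)) + f ((1 - e) * a)) := by
  rw [Fintype.sum_option, ← Equiv.sum_comp (Equiv.addLeft x), sum_zmod_two]
  simp [bscErasure]

lemma bscErasure_mem_stdSimplex (ha : a ∈ Set.Icc 0 1) (he : e ∈ Set.Icc 0 1) (x : ZMod 2) :
    bscErasure a e x ∈ stdSimplex ℝ (Option (ZMod 2)) := by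
  refine ⟨?_, (sum_comp_bscErasure a e x id).trans (by simp only [id]; ring)⟩
  rintro (_ | y)
  · exact he.1
  · exact mul_nonneg (sub_nonneg.2 he.2) (ite_nonneg (sub_nonneg.2 ha.2) ha.1)

lemma outputLaw_bscErasure (p a e : ℝ) :
    outputLaw (bern p) (bscErasure a e) = bscErasure (bconv p a) e 0 := by
  have hbit : ∀ y : ZMod 2, y = 0 ∨ y = 1 := by decide
  funext y
  rw [outputLaw, sum_bern_mul]
  rcases y with _ | y
  · simp only [bscErasure]; ring
  · rcases hbit y with rfl | rfl <;> simp [bscErasure, bconv] <;> ring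

lemma sum_negMulLog_bscErasure (a e : ℝ) (x : ZMod 2) :
    ∑ y, Real.negMulLog (bscErasure a e x y) =
      Real.binEntropy e + (1 - e) * (h2 a * Real.log 2) := by
  rw [sum_comp_bscErasure a e x Real.negMulLog, h2, div_mul_cancel₀ _ (Real.log_pos one_lt_two).ne',
    Real.negMulLog_mul, Real.negMulLog_mul, Real.binEntropy_eq_negMulLog_add_negMulLog_one_sub,
    Real.binEntropy_eq_negMulLog_add_negMulLog_one_sub]
  ring

lemma mutualInfo_bscErasure (hp : p ∈ Set.Icc 0 1) (ha : a ∈ Set.Icc 0 1) (he : e ∈ Set.Icc 0 1) :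
    mutualInfo (bern p) (bscErasure a e) =
      (1 - e) * (h2 (bconv p a) - h2 a) * Real.log 2 := by
  rw [mutualInfo_eq_sum_negMulLog (bern_mem_stdSimplex hp)
    (bscErasure_mem_stdSimplex ha he), outputLaw_bscErasure]
  simp only [sum_negMulLog_bscErasure, ← sum_mul, (bern_mem_stdSimplex hp).2]
  ring

lemma continuous_h2 : Continuous h2 := Real.binEntropy_continuous.div_const _

lemma continuous_h2_bconv (a : ℝ) : Continuous fun p => h2 (bconv p a) :=
  continuous_h2.comp (by unfold bconv; fun_prop)

lemma h2_le_h2_bconv (hp : p ∈ Set.Icc 0 1) (ha : a ∈ Set.Icc 0 1) : h2 a ≤ h2 (bconv p a) := by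
  have hconc := Real.strictConcave_binEntropy.concaveOn.2 ha (Set.Icc.one_sub_mem ha)
    (sub_nonneg.2 hp.2) hp.1 (sub_add_cancel 1 p)
  have hmix : (1 - p) • a + p • (1 - a) = bconv p a := add_comm _ _
  rw [hmix, Real.binEntropy_one_sub, ← add_smul, sub_add_cancel, one_smul] at hconc
  exact div_le_div_of_nonneg_right hconc (Real.log_pos one_lt_two).le

lemma exists_code_bscErasure (hp : p ∈ Set.Icc 0 1) (ha : a ∈ Set.Icc 0 1)
    (he : e ∈ Set.Icc 0 1) {R : ℝ} (hR : R < (1 - e) * (h2 (bconv p a) - h2 a))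
    {η ε : ℝ} (hη : 0 < η) (hε : 0 < ε) :
    ∀ᶠ n : ℕ in atTop, ∃ (M : ℕ) (enc : Fin M → Fin n → ZMod 2)
      (dec : (Fin n → Option (ZMod 2)) → Fin M),
      n * R ≤ Real.logb 2 M ∧ (∀ m, |∑ t, ((enc m t).val : ℝ) - n * p| ≤ n * η) ∧
      ∀ m, ∑ v with dec v ≠ m, ∏ t, bscErasure a e (enc m t) (v t) ≤ ε := by
  have hlog := Real.log_pos one_lt_two
  have hrate : R * Real.log 2 < mutualInfo (bern p) (bscErasure a e) := by
    rw [mutualInfo_bscErasure hp ha he]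
    gcongr
  filter_upwards [channel_coding (bern_mem_stdSimplex hp)
    (bscErasure_mem_stdSimplex ha he) (fun x => (x.val : ℝ)) hrate hη hε]
    with n ⟨M, enc, dec, hM, hones, herr⟩
  refine ⟨M, enc, dec, ?_, ?_, herr⟩
  · rw [Real.logb, le_div_iff₀ hlog, mul_assoc]
    exact (Real.le_log_iff_exp_le ((Real.exp_pos _).trans_le hM)).2 hM
  · simpa only [sum_bern_mul, ZMod.val_zero, ZMod.val_one, Nat.cast_zero, Nat.cast_one, mul_zero,
      mul_one, zero_add] using hones

lemma exists_code_bscErasure_le (hp : p ∈ Set.Icc 0 1) (ha : a ∈ Set.Icc 0 1)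
    (he : e ∈ Set.Icc 0 1) {R : ℝ} (hR : R < (1 - e) * (h2 (bconv p a) - h2 a))
    {δ ε : ℝ} (hδ : 0 < δ) (hε : 0 < ε) :
    ∀ᶠ n : ℕ in atTop, ∃ (M : ℕ) (enc : Fin M → Fin n → ZMod 2)
      (dec : (Fin n → Option (ZMod 2)) → Fin M),
      (p = 0 → ∀ m t, enc m t = 0) ∧ R ≤ Real.logb 2 M / n ∧
      (∀ m, (∑ t, ((enc m t).val : ℝ)) / n ∈ Set.Icc (p - δ) p) ∧
      ∀ m, ∑ v with dec v ≠ m, ∏ t, bscErasure a e (enc m t) (v t) ≤ ε := by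
  rcases hp.1.eq_or_lt with rfl | hp0
  · have hR0 : R ≤ 0 := by simpa [bconv] using hR.le
    refine .of_forall fun n => ⟨1, fun _ _ => 0, fun _ => 0, by simp, by simpa, by simp [hδ.le], ?_⟩
    intro m
    simp [Subsingleton.elim m 0, hε.le]
  have hcont : Continuous fun η => (1 - e) * (h2 (bconv (p - η) a) - h2 a) :=
    (((continuous_h2_bconv a).comp (continuous_sub_left p)).sub continuous_const).const_mul _
  have hnear : ∀ᶠ η in 𝓝[>] 0, R < (1 - e) * (h2 (bconv (p - η) a) - h2 a) :=
    (hcont.continuousWithinAt.tendsto.eventually_const_lt (by simpa using hR))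
  obtain ⟨η, hRη, hη0, hη⟩ :=
    (hnear.and (Ioo_mem_nhdsGT (lt_min hp0 (half_pos hδ)))).exists
  obtain ⟨hηp, hηδ⟩ := lt_min_iff.1 hη
  filter_upwards [exists_code_bscErasure ⟨sub_nonneg.2 hηp.le, by linarith [hp.2]⟩ ha he hRη
    hη0 hε, eventually_gt_atTop 0] with n ⟨M, enc, dec, hrate, hones, herr⟩ hn
  have hn : (0 : ℝ) < n := Nat.cast_pos.2 hn
  refine ⟨M, enc, dec, fun h => absurd h hp0.ne', by rwa [le_div_iff₀' hn], fun m => ?_, herr⟩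
  obtain ⟨hlow, hup⟩ := abs_le.1 (hones m)
  have hηδn : n * (2 * η) ≤ n * δ := by gcongr; linarith
  rw [Set.mem_Icc, le_div_iff₀' hn, div_le_iff₀' hn]
  constructor <;> linarith

end BinaryCodes

section SuccessiveDecoding

variable {N n : ℕ} {A E γ : ℝ} {p : Fin N → ℝ}

namespace PipeCode

variable (C : PipeCode N n)

lemma estInput_apply (pZ : Bits N → ℝ) (S : Fin N → Finset ℤ) (y : Fin n → Option (Bits N))
    {k : ℕ} {j : Fin N} (hj : (j : ℕ) < k) (t : Fin n) :
    C.estInput pZ S y k t j = C.enc j (C.decoded pZ S y j) t := by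
  induction k with
  | zero => exact absurd hj (Nat.not_lt_zero _)
  | succ k ih =>
    rcases (Nat.lt_succ_iff.1 hj).eq_or_lt with rfl | hjk
    · rw [estInput, dif_pos j.2]
      exact Function.update_self ..
    · rw [estInput]
      split_ifs with hk
      · exact (Function.update_of_ne (Fin.ne_of_val_ne hjk.ne) _ _).trans (ih hjk)
      · exact ih hjk

-- Induction on the bit-pipes: while the decoded messages are correct, the receiver processes the
-- next output exactly as if the true input were known.
lemma decoded_eq_of_forall_dec_eq (pZ : Bits N → ℝ) {S : Fin N → Finset ℤ}
    (hS : ∀ i, ∀ j ∈ S i, j < (i : ℤ)) {m : (i : Fin N) → Fin (C.M i)}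
    {y : Fin n → Option (Bits N)}
    (h : ∀ i, (C.dec i fun t => flipOutput pZ (S i) i (C.input m t) (y t)) = m i) (i : Fin N) :
    C.decoded pZ S y i = m i := by
  induction i using WellFoundedLT.induction with
  | ind i ih =>
    rw [← h i, decoded]
    congr 1
    funext t
    refine flipOutput_congr pZ (hS i) (fun j hj => ?_) (y t)
    rw [C.estInput_apply pZ S y hj, ih j hj, input]

lemma errorProb_le {pZ : Bits N → ℝ} (hpZ : pZ ∈ stdSimplex ℝ (Bits N)) {e : ℝ}
    (he : e ∈ Set.Icc 0 1) {S : Fin N → Finset ℤ} (hS : ∀ i, ∀ j ∈ S i, j < (i : ℤ))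
    (m : (i : Fin N) → Fin (C.M i)) :
    C.errorProb pZ e S m ≤ ∑ i, ∑ v with C.dec i v ≠ m i,
      ∏ t, bscErasure (crossover pZ (S i) i) e (C.enc i (m i) t) (v t) := by
  have hunion (y : Fin n → Option (Bits N)) (hy : ∃ i, C.decoded pZ S y i ≠ m i) :
      ∃ i, (C.dec i fun t => flipOutput pZ (S i) i (C.input m t) (y t)) ≠ m i := by
    contrapose! hy
    exact C.decoded_eq_of_forall_dec_eq pZ hS hy
  exact (blockProb_le_sum hpZ he (C.input m) hunion).trans_eq <| sum_congr rfl fun i _ =>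
    blockProb_comp_flipOutput hpZ e (S i) i (C.input m) fun v => C.dec i v ≠ m i

lemma peakConstraint_of_sum_le (hγ : 0 < γ) {s : Finset (Fin N)}
    (hzero : ∀ i ∉ s, ∀ m t, C.enc i m t = 0) (hs : ∑ i ∈ s, (2 : ℝ) ^ (i : ℕ) ≤ γ * A) :
    C.PeakConstraint γ A := by
  intro m t
  rw [div_le_iff₀' hγ]
  refine le_trans ?_ hs
  have hsupport : decimal (C.input m t) = ∑ i ∈ s, ((C.input m t i).val : ℝ) * 2 ^ (i : ℕ) :=
    (sum_subset (subset_univ s) fun i _ hi => by simp [input, hzero i hi]).symm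
  rw [hsupport]
  refine sum_le_sum fun i _ => mul_le_of_le_one_left (by positivity) ?_
  exact_mod_cast Nat.lt_succ_iff.1 (ZMod.val_lt (C.input m t i))

lemma average_decimal_input (m : (i : Fin N) → Fin (C.M i)) (γ : ℝ) :
    (∑ t, decimal (C.input m t) / γ) / n =
      (∑ i, C.onesFraction i (m i) * 2 ^ (i : ℕ)) / γ := by
  simp only [decimal, onesFraction, input, ← sum_div, div_mul_eq_mul_div, sum_mul]
  rw [sum_comm, div_right_comm]

lemma averageConstraint_of_onesFraction_le (hγ : 0 < γ) (hones : ∀ i m, C.onesFraction i m ≤ p i)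
    (hp : ∑ i, p i * (2 : ℝ) ^ (i : ℕ) ≤ γ * E) : C.AverageConstraint γ E := by
  intro m
  rw [average_decimal_input, div_le_iff₀' hγ]
  exact (sum_le_sum fun i _ => by gcongr; exact hones i (m i)).trans hp

end PipeCode

lemma mem_admissible_iff : p ∈ admissible A E γ N ↔ (∀ i, p i ∈ Set.Icc 0 1) ∧
    ∑ i with 0 < p i, (2 : ℝ) ^ (i : ℕ) ≤ γ * A ∧ ∑ i, p i * (2 : ℝ) ^ (i : ℕ) ≤ γ * E := by
  refine and_congr_right fun hp => and_congr_right fun _ => ?_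
  rw [sum_filter_of_ne fun i _ hi => (hp i).1.lt_of_ne' (left_ne_zero_of_mul hi)]

theorem achieves_of_mem_admissible (hγ : 0 < γ) {pZ : Bits N → ℝ}
    (hpZ : pZ ∈ stdSimplex ℝ (Bits N)) {e : ℝ} (he : e ∈ Set.Icc 0 1) {S : Fin N → Finset ℤ}
    (hS : ∀ i, ∀ j ∈ S i, j < (i : ℤ)) (hp : p ∈ admissible A E γ N) {R : ℝ}
    (hR : R ≤ (1 - e) * sumRate (fun i => crossover pZ (S i) i) p) :
    Achieves A E γ pZ e S p R := by
  obtain ⟨hp01, hpeak, haverage⟩ := mem_admissible_iff.1 hp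
  intro δ hδ
  obtain ⟨δ', hδ', hNδ⟩ : ∃ δ' > 0, N * δ' ≤ δ :=
    ⟨δ / (N + 1), by positivity, by rw [mul_div_assoc', div_le_iff₀] <;> nlinarith⟩
  rw [← eventually_atTop]
  filter_upwards [eventually_all.2 fun i => exists_code_bscErasure_le (hp01 i)
    (crossover_mem_Icc hpZ (S i) i) he (sub_lt_self _ hδ') hδ hδ'] with n hcode
  choose M enc dec hzero hrate hones herr using hcode
  set C : PipeCode N n := ⟨M, enc, dec⟩
  have hones (i : Fin N) (m : Fin (C.M i)) : C.onesFraction i m ∈ Set.Icc (p i - δ) (p i) :=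
    hones i m
  refine ⟨C, hzero, fun i m => ?_, C.peakConstraint_of_sum_le hγ (fun i hi => ?_) hpeak,
    C.averageConstraint_of_onesFraction_le hγ (fun i m => (hones i m).2) haverage, ?_, fun m => ?_⟩
  · rw [abs_sub_comm, abs_of_nonneg (sub_nonneg.2 (hones i m).2), sub_le_comm]
    exact (hones i m).1
  · exact hzero i (le_antisymm (by simpa using hi) (hp01 i).1)
  · calc R - δ
      _ ≤ (1 - e) * sumRate (fun i => crossover pZ (S i) i) p - N * δ' := by gcongr
      _ = ∑ i, ((1 - e) * (h2 (bconv (p i) (crossover pZ (S i) i)) -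
            h2 (crossover pZ (S i) i)) - δ') := by
          rw [sum_sub_distrib, ← mul_sum, sumRate]
          simp
      _ ≤ ∑ i, Real.logb 2 (M i) / n := sum_le_sum fun i _ => hrate i
      _ = C.rate := (sum_div ..).symm
  · calc C.errorProb pZ e S m
      _ ≤ _ := C.errorProb_le hpZ he hS m
      _ ≤ ∑ _ : Fin N, δ' := sum_le_sum fun i _ => herr i (m i)
      _ ≤ δ := by simpa using hNδ

end SuccessiveDecoding

section Optimum

variable {N : ℕ}

lemma sumRate_nonneg {a p : Fin N → ℝ} (ha : ∀ i, a i ∈ Set.Icc 0 1)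
    (hp : ∀ i, p i ∈ Set.Icc 0 1) : 0 ≤ sumRate a p :=
  sum_nonneg fun i _ => sub_nonneg.2 (h2_le_h2_bconv (hp i) (ha i))

lemma continuous_sumRate (a : Fin N → ℝ) : Continuous (sumRate a) := by
  unfold sumRate
  exact continuous_finsetSum _ fun i _ =>
    ((continuous_h2_bconv (a i)).comp (continuous_apply i)).sub continuous_const

lemma lowerSemicontinuous_sum_filter_pos {ι : Type*} [Fintype ι] {w : ι → ℝ} (hw : ∀ i, 0 ≤ w i) :
    LowerSemicontinuous fun p : ι → ℝ => ∑ i with 0 < p i, w i := by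
  simp only [sum_filter]
  refine lowerSemicontinuous_sum fun i _ => ?_
  exact (isOpen_lt continuous_const (continuous_apply i)).lowerSemicontinuous_indicator (hw i)

lemma isCompact_admissible (A E γ : ℝ) (N : ℕ) : IsCompact (admissible A E γ N) := by
  have hinter : admissible A E γ N = (Set.univ.pi fun _ => Set.Icc 0 1) ∩
      ({p : Fin N → ℝ | ∑ i with 0 < p i, (2 : ℝ) ^ (i : ℕ) ≤ γ * A} ∩
        {p : Fin N → ℝ | ∑ i, p i * (2 : ℝ) ^ (i : ℕ) ≤ γ * E}) := by
    ext p
    rw [mem_admissible_iff, Set.mem_inter_iff, Set.mem_univ_pi]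
    rfl
  rw [hinter]
  refine (isCompact_univ_pi fun _ => isCompact_Icc).inter_right (IsClosed.inter ?_ ?_)
  · exact (lowerSemicontinuous_sum_filter_pos fun i => by positivity).isClosed_preimage (γ * A)
  · exact isClosed_le (by fun_prop) continuous_const

lemma exists_isGreatest_sumRate {A E γ : ℝ} (hA : 0 ≤ A) (hE : 0 ≤ E) (hγ : 0 ≤ γ)
    (a : Fin N → ℝ) :
    ∃ p ∈ admissible A E γ N, IsGreatest (sumRate a '' admissible A E γ N) (sumRate a p) := by
  have hzero : 0 ∈ admissible A E γ N :=
    ⟨by simp, by simpa using mul_nonneg hγ hA, by simpa using mul_nonneg hγ hE⟩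
  obtain ⟨p, hp, hmax⟩ := (isCompact_admissible A E γ N).exists_isMaxOn ⟨0, hzero⟩
    (continuous_sumRate a).continuousOn
  exact ⟨p, hp, Set.mem_image_of_mem _ hp, Set.forall_mem_image.2 hmax⟩

end Optimum

end IMDD

theorem theorem4_general {N : ℕ} {A E γ : ℝ} (hA : 0 ≤ A) (hE : 0 ≤ E) (hγ : 0 < γ)
    {S : Fin N → Finset ℤ} (hS : ∀ i, ∀ j ∈ S i, j < (i : ℤ))
    {pZ : IMDD.Bits N → ℝ} (hpZ : pZ ∈ stdSimplex ℝ (IMDD.Bits N))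
    {e ebar : ℝ} (he01 : e ∈ Set.Icc 0 1) (he : e ≤ ebar)
    {a : Fin N → ℝ} (ha : ∀ i, a i = IMDD.crossover pZ (S i) i) :
    (∀ (i : Fin N) (n : ℕ) (x : Fin n → IMDD.Bits N) (v : Fin n → Option (ZMod 2)),
      IMDD.blockProb pZ e x (fun y => ∀ t, IMDD.flipOutput pZ (S i) i (x t) (y t) = v t) =
        ∏ t, IMDD.bscErasure (a i) e (x t i) (v t)) ∧
    (∀ p ∈ IMDD.admissible A E γ N,
      IMDD.Achieves A E γ pZ e S p ((1 - ebar) * IMDD.sumRate a p)) ∧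
    (∃ R, IsGreatest (IMDD.sumRate a '' IMDD.admissible A E γ N) R ∧
      ∃ p ∈ IMDD.admissible A E γ N, IMDD.Achieves A E γ pZ e S p ((1 - ebar) * R)) := by
  obtain rfl : a = fun i => IMDD.crossover pZ (S i) i := funext ha
  have hachieves : ∀ p ∈ IMDD.admissible A E γ N, IMDD.Achieves A E γ pZ e S p
      ((1 - ebar) * IMDD.sumRate (fun i => IMDD.crossover pZ (S i) i) p) := fun p hp =>
    IMDD.achieves_of_mem_admissible hγ hpZ he01 hS hp <| mul_le_mul_of_nonneg_right
      (sub_le_sub_left he 1)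
      (IMDD.sumRate_nonneg (fun i => IMDD.crossover_mem_Icc hpZ (S i) i) hp.1)
  obtain ⟨p, hp, hmax⟩ := IMDD.exists_isGreatest_sumRate hA hE hγ.le
    fun i => IMDD.crossover pZ (S i) i
  exact ⟨fun i _ x v => IMDD.blockProb_flipOutput hpZ e (S i) i x v, hachieves,
    _, hmax, p, hp, hachieves p hp⟩

theorem theorem4 (A E β γ : ℝ) (hA : 0 < A) (hE : 0 < E) (hβ : 0 < β) (hγ : 0 < γ)
    (N : ℕ) (hN : (N : ℤ) = ⌈Real.logb 2 (γ * (A + 2 * β))⌉)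
    (q : ℕ) (hq1 : 1 ≤ q) (hqN : q ≤ N - 1)
    (S : Fin N → Finset ℤ)
    (hS : ∀ i, (S i).card = q ∧ S i ⊆ Finset.Icc ((i : ℤ) - N + 1) ((i : ℤ) - 1))
    (pZ : IMDD.Bits N → ℝ) (hpZ : pZ = IMDD.noiseLaw A β γ N)
    (ebar : ℝ) (hebar : ebar = 2 * IMDD.gaussianQ β)
    (e : ℝ) (he0 : 0 ≤ e) (he : e ≤ ebar)
    (a : Fin N → ℝ) (ha : ∀ i, a i = IMDD.crossover pZ (S i) i) :
    (∀ (i : Fin N) (n : ℕ) (x : Fin n → IMDD.Bits N) (v : Fin n → Option (ZMod 2)),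
      IMDD.blockProb pZ e x (fun y => ∀ t, IMDD.flipOutput pZ (S i) i (x t) (y t) = v t) =
        ∏ t, IMDD.bscErasure (a i) e (x t i) (v t)) ∧
    (∀ p ∈ IMDD.admissible A E γ N,
      IMDD.Achieves A E γ pZ e S p ((1 - ebar) * IMDD.sumRate a p)) ∧
    (∃ R, IsGreatest (IMDD.sumRate a '' IMDD.admissible A E γ N) R ∧
      ∃ p ∈ IMDD.admissible A E γ N, IMDD.Achieves A E γ pZ e S p ((1 - ebar) * R)) := by
  exact theorem4_general hA.le hE.le hγ
    (fun i j hj => Int.lt_of_le_sub_one (Finset.mem_Icc.1 ((hS i).2 hj)).2)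
    (hpZ ▸ IMDD.noiseLaw_mem_stdSimplex hA hβ hγ N)
    ⟨he0, by linarith [IMDD.gaussianQ_lt_half hβ]⟩ he ha
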